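/- Let $r\ge 2$, let $\mathbb{F}_q$ be a finite field with $q$ elements, and fix a monomial order on $\mathbb{F}_q[x_1,\dots,x_r]$ (for example the degree-lexicographic one); a polynomial is monic if its leading coefficient is $1$. For $n\ge 0$ let $R_{r,n}(\mathbb{F}_q)$ be the set of monic polynomials in $\mathbb{F}_q[x_1,\dots,x_r]$ of total degree $n$ that are not irreducible (so that $R_{r,0}(\mathbb{F}_q)=\{1\}$), which is a finite set, and let $$\rho_{r,n}(q)=q^{\binom{r+n-1}{r}+r-1}\,\frac{1-q^{-r}}{(1-q^{-1})^2}.$$ Then $$\#R_{r,0}(\mathbb{F}_q)=1,\qquad \#R_{r,1}(\mathbb{F}_q)=0,\qquad \#R_{r,2}(\mathbb{F}_q)=\frac{\rho_{r,2}(q)}{2}\,(1-q^{-r-1}),$$ $$\bigl|\#R_{r,3}(\mathbb{F}_q)-\rho_{r,3}(q)\bigr|=\rho_{r,3}(q)\left(q^{-r(r+1)/2}+q^{-r(r-1)/2}\,\frac{1-2q^{-r}+2q^{-2r-1}-q^{-2r-2}}{3(1-q^{-1})}\right)\le\rho_{r,3}(q)\,q^{-r(r-1)/2},$$ and for $n\ge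 4$ $$\bigl|\#R_{r,n}(\mathbb{F}_q)-\rho_{r,n}(q)\bigr|\le\rho_{r,n}(q)\,\frac{q^{-\binom{r+n-2}{r-1}+r(r+1)/2}}{(1-q^{-1})(1-q^{-r})}\le\rho_{r,n}(q)\cdot 3\,q^{-\binom{r+n-2}{r-1}+r(r+1)/2}.$$ -/

import Mathlib

/-- The set `P_{r,n}(F)`: `r`-variate polynomials over `F` of total degree exactly `n` whose leading
coefficient with respect to the monomial order `m` equals `1`. (Being monic, they are nonzero.) -/
def monicOfDegree {r : ℕ} (F : Type*) [Field F] (m : MonomialOrder (Fin r)) (n : ℕ) :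
    Set (MvPolynomial (Fin r) F) :=
  {f | m.Monic f ∧ f.totalDegree = n}

/-- The set `I_{r,n}(F)` of irreducible monic `r`-variate polynomials of degree `n`. -/
def irreducibleMonic {r : ℕ} (F : Type*) [Field F] (m : MonomialOrder (Fin r)) (n : ℕ) :
    Set (MvPolynomial (Fin r) F) :=
  {f ∈ monicOfDegree F m n | Irreducible f}

/-- The set `R_{r,n}(F) = P_{r,n}(F) \ I_{r,n}(F)` of reducible monic polynomials of degree `n`. By
this convention the constant `1` is counted as reducible. -/
def reducibleMonic {r : ℕ} (F : Type*) [Field F] (m : MonomialOrder (Fin r)) (n : ℕ) :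
    Set (MvPolynomial (Fin r) F) :=
  monicOfDegree F m n \ irreducibleMonic F m n

/-- The main term
`ρ_{r,n}(q) = q^{binom(r+n-1,r)+r-1} (1 - q^{-r}) / (1 - q^{-1})^2`. -/
noncomputable def rho (r n : ℕ) (q : ℝ) : ℝ :=
  q ^ ((r + n - 1).choose r + r - 1) * ((1 - q ^ (-(r : ℤ))) / (1 - q ^ (-1 : ℤ)) ^ 2)

open MvPolynomial

/-! Write `P_n`, `I_n`, `R_n` for the numbers of all, irreducible and reducible monic polynomials of
degree `n`, and `b_n = binom(r+n, r)`. Counting up to scalars gives `P_n = (q^{b_n} -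
q^{b_{n-1}})/(q-1)` for `n ≥ 1`, and `rho r n q = P_1 q^{b_{n-1}}/(q-1)`: a typical reducible
polynomial is a linear one times an arbitrary cofactor.

Upper bound: every reducible polynomial is a product of monic factors of degrees `k` and `n-k` with
`1 ≤ k ≤ n/2`. The exponents `b_k + b_{n-k}` strictly decrease in `k`, so the terms with `k ≥ 2` are
dominated by a geometric series starting at `k = 2` (`sum_ncard_mul_ncard_le`). Lower bound: by
unique factorization, linear times irreducible is injective, so `R_n ≥ P_1 (P_{n-1} - R_{n-1})`, and
`R_{n-1}` is small by the same series. The two meet in `abs_ncard_reducibleMonic_sub_rho_le`.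

In degrees 2 and 3 a reducible polynomial has a linear factor, and counting multisets of linear
factors gives exact formulas. -/

theorem card_exponents_degree_le (r n : ℕ) :
    Nat.card {d : Fin (r + 1) →₀ ℕ | (d.sum fun _ e => e) ≤ n} = (r + 1 + n).choose (r + 1) := by
  classical
  have key : ∀ n, {d : Fin (r + 1) →₀ ℕ | (d.sum fun _ e => e) ≤ n} =
      ((Finset.range (n + 1)).biUnion fun k =>
        (Finset.univ : Finset (Fin (r + 1))).finsuppAntidiag k : Finset _) := by
    intro n
    ext d
    simp [Finsupp.sum_fintype]
  rw [key, Nat.card_coe_set_eq, Set.ncard_coe_finset, Finset.card_biUnion]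
  · simp only [Finset.card_finsuppAntidiag_nat_eq_choose, Finset.card_univ, Fintype.card_fin]
    induction n with
    | zero => simp
    | succ n ih =>
      rw [Finset.sum_range_succ, ih, show r + 1 + (n + 1) = (r + 1 + n) + 1 by ring,
        Nat.choose_succ_succ, add_comm]
      congr 1
      rw [show r + 1 + n + 1 - 1 = r + (n + 1) by omega, show r + 1 + n = r + (n + 1) by ring,
        Nat.choose_symm_add]
  · intro a _ b _ hab
    rw [Function.onFun, Finset.disjoint_left]
    intro d h1 h2
    rw [Finset.mem_finsuppAntidiag] at h1 h2
    exact hab (h1.1.symm.trans h2.1)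

/-! ### Counting monic polynomials of a given degree. -/

section

variable {F : Type*} [Field F] {r : ℕ} {m : MonomialOrder (Fin r)}

theorem ncard_totalDegree_le (F : Type*) [Field F] [Fintype F] (s n : ℕ) :
    {f : MvPolynomial (Fin (s + 1)) F | f.totalDegree ≤ n}.ncard =
      Fintype.card F ^ (s + 1 + n).choose (s + 1) := by
  have h : {f : MvPolynomial (Fin (s + 1)) F | f.totalDegree ≤ n} =
      (restrictTotalDegree (Fin (s + 1)) F n : Set _) := by
    ext f; simp [mem_restrictTotalDegree]
  rw [h, ← Nat.card_coe_set_eq]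
  change Nat.card (restrictTotalDegree (Fin (s + 1)) F n) = _
  rw [Module.natCard_eq_pow_finrank (K := F), Nat.card_eq_fintype_card,
    ← card_exponents_degree_le]
  congr 1
  exact Module.finrank_eq_nat_card_basis (basisRestrictSupport F _)

theorem finite_totalDegree_le (F : Type*) [Field F] [Fintype F] (r n : ℕ) :
    {f : MvPolynomial (Fin r) F | f.totalDegree ≤ n}.Finite := by
  have h : {f : MvPolynomial (Fin r) F | f.totalDegree ≤ n} =
      (restrictTotalDegree (Fin r) F n : Set _) := by
    ext f; simp [mem_restrictTotalDegree]
  rw [h]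
  have : Finite (restrictTotalDegree (Fin r) F n) := Module.finite_of_finite F
  exact Set.toFinite _

theorem finite_monicOfDegree [Fintype F] (m : MonomialOrder (Fin r)) (n : ℕ) :
    (monicOfDegree F m n).Finite :=
  (finite_totalDegree_le F r n).subset fun _ hf => hf.2.le

theorem finite_reducibleMonic [Fintype F] (m : MonomialOrder (Fin r)) (n : ℕ) :
    (reducibleMonic F m n).Finite :=
  (finite_monicOfDegree m n).subset Set.sdiff_subset

theorem leadingCoeff_C_mul' (c : F) (f : MvPolynomial (Fin r) F) :
    m.leadingCoeff (C c * f) = c * m.leadingCoeff f := by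
  rw [MonomialOrder.leadingCoeff_mul, MonomialOrder.leadingCoeff_C]

theorem totalDegree_C_mul' {c : F} (hc : c ≠ 0) (f : MvPolynomial (Fin r) F) :
    (C c * f).totalDegree = f.totalDegree := by
  by_cases hf : f = 0
  · simp [hf]
  · rw [totalDegree_mul_of_isDomain (by simpa using hc) hf, totalDegree_C, zero_add]

theorem ncard_monicOfDegree_zero (m : MonomialOrder (Fin r)) :
    (monicOfDegree F m 0).ncard = 1 := by
  rw [Set.ncard_eq_one]
  refine ⟨1, ?_⟩
  ext f
  simp only [monicOfDegree, Set.mem_ofPred_eq, Set.mem_singleton_iff]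
  constructor
  · rintro ⟨h1, h2⟩
    rw [totalDegree_eq_zero_iff_eq_C] at h2
    rw [h2, MonomialOrder.Monic, MonomialOrder.leadingCoeff_C] at h1
    rw [h2, h1, C_1]
  · rintro rfl
    exact ⟨m.monic_one, totalDegree_one⟩

/-- A nonzero polynomial is uniquely a unit times a monic one. The degree `n + 1` excludes `0`,
whose `totalDegree` is `0`. -/
theorem ncard_totalDegree_eq [Fintype F] (m : MonomialOrder (Fin r)) (n : ℕ) :
    {f : MvPolynomial (Fin r) F | f.totalDegree = n + 1}.ncard =
      (Fintype.card F - 1) * (monicOfDegree F m (n + 1)).ncard := by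
  classical
  rw [← Fintype.card_units, ← Nat.card_eq_fintype_card, ← Nat.card_coe_set_eq (monicOfDegree _ _ _),
    ← Nat.card_prod, ← Nat.card_coe_set_eq]
  symm
  refine Nat.card_congr (Equiv.ofBijective
    (fun p : Fˣ × monicOfDegree F m (n + 1) =>
      ⟨C (p.1 : F) * p.2.1, (totalDegree_C_mul' p.1.ne_zero _).trans p.2.2.2⟩) ⟨?_, ?_⟩)
  · rintro ⟨u, f, hf⟩ ⟨v, g, hg⟩ h
    simp only [Subtype.mk.injEq] at h
    have h' := congrArg m.leadingCoeff h
    rw [leadingCoeff_C_mul', leadingCoeff_C_mul', hf.1.leadingCoeff_eq_one,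
      hg.1.leadingCoeff_eq_one, mul_one, mul_one] at h'
    rw [h'] at h
    have := mul_left_cancel₀ (by simp) h
    ext1
    · exact Units.ext h'
    · exact Subtype.ext this
  · rintro ⟨f, hf⟩
    have hf0 : m.leadingCoeff f ≠ 0 := by
      rw [MonomialOrder.leadingCoeff_ne_zero_iff]
      rintro rfl
      simp at hf
    refine ⟨⟨Units.mk0 _ hf0, C (m.leadingCoeff f)⁻¹ * f, ?_, ?_⟩, ?_⟩
    · rw [MonomialOrder.Monic, leadingCoeff_C_mul', inv_mul_cancel₀ hf0]
    · rw [totalDegree_C_mul' (inv_ne_zero hf0)]; exact hf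
    · simp only [Units.val_mk0, ← mul_assoc, ← C_mul, mul_inv_cancel₀ hf0, C_1, one_mul]

theorem ncard_monicOfDegree_succ [Fintype F] {s : ℕ} (m : MonomialOrder (Fin (s + 1))) (n : ℕ) :
    (Fintype.card F - 1) * (monicOfDegree F m (n + 1)).ncard +
      Fintype.card F ^ (s + 1 + n).choose (s + 1) =
      Fintype.card F ^ (s + 1 + (n + 1)).choose (s + 1) := by
  rw [← ncard_totalDegree_eq, ← ncard_totalDegree_le, ← ncard_totalDegree_le, add_comm]
  refine (Set.ncard_union_eq (t := {f | f.totalDegree = n + 1}) ?_ (finite_totalDegree_le F _ n)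
    ((finite_totalDegree_le F _ (n + 1)).subset fun f hf => le_of_eq hf)).symm.trans ?_
  · rw [Set.disjoint_left]
    intro f h1 h2
    simp only [Set.mem_ofPred_eq] at h1 h2
    omega
  · congr 1
    ext f
    simp only [Set.mem_union, Set.mem_ofPred_eq]
    omega

/-! ### Reducible polynomials as products of monic factors. -/

theorem mul_mem_monicOfDegree {a b : ℕ} {f g : MvPolynomial (Fin r) F}
    (hf : f ∈ monicOfDegree F m a) (hg : g ∈ monicOfDegree F m b) :
    f * g ∈ monicOfDegree F m (a + b) :=
  ⟨hf.1.mul hg.1, by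
    rw [totalDegree_mul_of_isDomain hf.1.ne_zero hg.1.ne_zero, hf.2, hg.2]⟩

theorem not_isUnit_of_totalDegree {f : MvPolynomial (Fin r) F} (h : f.totalDegree ≠ 0) :
    ¬ IsUnit f := fun hu => h (isUnit_iff_totalDegree_of_isReduced.mp hu).2

theorem isUnit_of_totalDegree {f : MvPolynomial (Fin r) F} (h0 : f ≠ 0) (h : f.totalDegree = 0) :
    IsUnit f := by
  rw [totalDegree_eq_zero_iff_eq_C] at h
  rw [h] at h0 ⊢
  exact (IsUnit.mk0 _ (by simpa using h0)).map C

theorem mul_mem_reducibleMonic {a b : ℕ} {f g : MvPolynomial (Fin r) F}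
    (hf : f ∈ monicOfDegree F m (a + 1)) (hg : g ∈ monicOfDegree F m (b + 1)) :
    f * g ∈ reducibleMonic F m (a + 1 + (b + 1)) := by
  refine ⟨mul_mem_monicOfDegree hf hg, fun h => ?_⟩
  rcases h.2.isUnit_or_isUnit rfl with h | h
  · exact not_isUnit_of_totalDegree (by rw [hf.2]; simp) h
  · exact not_isUnit_of_totalDegree (by rw [hg.2]; simp) h

theorem exists_factors_of_mem_reducibleMonic {n : ℕ} (hn : n ≠ 0) {f : MvPolynomial (Fin r) F}
    (hf : f ∈ reducibleMonic F m n) :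
    ∃ k ∈ Finset.Icc 1 (n / 2), ∃ g ∈ monicOfDegree F m k, ∃ h ∈ monicOfDegree F m (n - k),
      f = g * h := by
  have hu : ¬ IsUnit f := not_isUnit_of_totalDegree (by rw [hf.1.2]; exact hn)
  have hirr : ¬ Irreducible f := fun h => hf.2 ⟨hf.1, h⟩
  rw [irreducible_iff] at hirr
  push Not at hirr
  obtain ⟨a, b, hab, ha, hb⟩ := hirr hu
  have hf0 : f ≠ 0 := hf.1.1.ne_zero
  have ha0 : a ≠ 0 := by rintro rfl; simp [hab] at hf0
  have hb0 : b ≠ 0 := by rintro rfl; simp [hab] at hf0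
  have hlc : m.leadingCoeff a * m.leadingCoeff b = 1 := by
    rw [← MonomialOrder.leadingCoeff_mul, ← hab]; exact hf.1.1
  have hdeg : a.totalDegree + b.totalDegree = n := by
    rw [← totalDegree_mul_of_isDomain ha0 hb0, ← hab]; exact hf.1.2
  have hda : a.totalDegree ≠ 0 := fun h => ha (isUnit_of_totalDegree ha0 h)
  have hdb : b.totalDegree ≠ 0 := fun h => hb (isUnit_of_totalDegree hb0 h)
  -- The leading coefficients of `a` and `b` are mutually inverse, so scaling each factor by the
  -- other's makes both monic and keeps the product.
  have hA : C (m.leadingCoeff b) * a ∈ monicOfDegree F m a.totalDegree :=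
    ⟨by rw [MonomialOrder.Monic, leadingCoeff_C_mul', mul_comm, hlc],
      totalDegree_C_mul' (right_ne_zero_of_mul_eq_one hlc) _⟩
  have hB : C (m.leadingCoeff a) * b ∈ monicOfDegree F m b.totalDegree :=
    ⟨by rw [MonomialOrder.Monic, leadingCoeff_C_mul', hlc],
      totalDegree_C_mul' (left_ne_zero_of_mul_eq_one hlc) _⟩
  have hprod : f = (C (m.leadingCoeff b) * a) * (C (m.leadingCoeff a) * b) := by
    rw [mul_mul_mul_comm, ← C_mul, mul_comm (m.leadingCoeff b), hlc, C_1, one_mul, hab]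
  rcases le_total a.totalDegree b.totalDegree with h | h
  · refine ⟨a.totalDegree, Finset.mem_Icc.mpr ⟨by omega, by omega⟩, _, hA, _, ?_, hprod⟩
    rwa [← hdeg, Nat.add_sub_cancel_left]
  · refine ⟨b.totalDegree, Finset.mem_Icc.mpr ⟨by omega, by omega⟩, _, hB, _, ?_,
      hprod.trans (mul_comm _ _)⟩
    rwa [← hdeg, Nat.add_sub_cancel]

theorem ncard_reducibleMonic_le [Fintype F] (m : MonomialOrder (Fin r)) {n : ℕ} (hn : n ≠ 0) :
    (reducibleMonic F m n).ncard ≤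
      ∑ k ∈ Finset.Icc 1 (n / 2), (monicOfDegree F m k).ncard * (monicOfDegree F m (n - k)).ncard := by
  have hfin : ∀ k, (Set.image2 (· * ·) (monicOfDegree F m k) (monicOfDegree F m (n - k))).Finite :=
    fun k => (finite_monicOfDegree m k).image2 _ (finite_monicOfDegree m _)
  calc (reducibleMonic F m n).ncard
      ≤ (⋃ k ∈ Finset.Icc 1 (n / 2),
          Set.image2 (· * ·) (monicOfDegree F m k) (monicOfDegree F m (n - k))).ncard := by
        refine Set.ncard_le_ncard (fun f hf => ?_) (Set.Finite.biUnion (Finset.finite_toSet _) fun k _ => hfin k)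
        obtain ⟨k, hk, g, hg, h, hh, rfl⟩ := exists_factors_of_mem_reducibleMonic hn hf
        exact Set.mem_biUnion hk ⟨g, hg, h, hh, rfl⟩
    _ ≤ ∑ k ∈ Finset.Icc 1 (n / 2),
          (Set.image2 (· * ·) (monicOfDegree F m k) (monicOfDegree F m (n - k))).ncard :=
        Finset.set_ncard_biUnion_le _ _
    _ ≤ _ := Finset.sum_le_sum fun k _ => by
        rw [← Set.image_prod, ← Set.ncard_prod]
        exact Set.ncard_image_le ((finite_monicOfDegree m k).prod (finite_monicOfDegree m _))

theorem reducibleMonic_zero (m : MonomialOrder (Fin r)) :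
    reducibleMonic F m 0 = monicOfDegree F m 0 := by
  refine sdiff_eq_left.mpr (Set.disjoint_left.mpr ?_)
  rintro f h1 hf
  exact hf.2.not_isUnit (isUnit_of_totalDegree h1.1.ne_zero h1.2)

theorem reducibleMonic_one (m : MonomialOrder (Fin r)) : reducibleMonic F m 1 = ∅ := by
  rw [Set.eq_empty_iff_forall_notMem]
  intro f hf
  obtain ⟨k, hk, -⟩ := exists_factors_of_mem_reducibleMonic one_ne_zero hf
  simp at hk

theorem irreducible_of_mem_monicOfDegree_one {f : MvPolynomial (Fin r) F}
    (hf : f ∈ monicOfDegree F m 1) : Irreducible f := by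
  by_contra h
  have : f ∈ reducibleMonic F m 1 := ⟨hf, fun h' => h h'.2⟩
  rw [reducibleMonic_one] at this
  exact this

theorem ncard_irreducibleMonic_add [Fintype F] (m : MonomialOrder (Fin r)) (n : ℕ) :
    (irreducibleMonic F m n).ncard + (reducibleMonic F m n).ncard = (monicOfDegree F m n).ncard := by
  rw [add_comm]
  exact Set.ncard_sdiff_add_ncard_of_subset (fun _ hf => hf.1) (finite_monicOfDegree m n)

/-! ### Unique factorization and the lower bound. -/

theorem eq_of_associated_of_monic {f g : MvPolynomial (Fin r) F} (hf : m.Monic f) (hg : m.Monic g)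
    (h : Associated f g) : f = g := by
  obtain ⟨u, rfl⟩ := h
  obtain ⟨c, hc⟩ := (isUnit_iff_eq_C_of_isReduced.mp u.isUnit)
  rw [hc.2, mul_comm, MonomialOrder.Monic, leadingCoeff_C_mul', hf.leadingCoeff_eq_one, mul_one] at hg
  rw [hc.2, hg, C_1, mul_one]

/-- Unique factorization into monic irreducible polynomials. -/
theorem eq_of_prod_eq_of_monic_irreducible {s t : Multiset (MvPolynomial (Fin r) F)}
    (hs : ∀ f ∈ s, m.Monic f ∧ Irreducible f) (ht : ∀ f ∈ t, m.Monic f ∧ Irreducible f)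
    (h : s.prod = t.prod) : s = t := by
  have := UniqueFactorizationMonoid.factors_unique (fun f hf => (hs f hf).2)
    (fun f hf => (ht f hf).2) (h ▸ Associated.refl _)
  rw [← Multiset.rel_eq]
  exact this.mono fun a ha b hb hab => eq_of_associated_of_monic (hs a ha).1 (ht b hb).1 hab

/-- The degree tells the linear factor from the other one; for `n = 1` the two could be swapped. -/
theorem injOn_mul_irreducibleMonic (m : MonomialOrder (Fin r)) {n : ℕ} (hn : n ≠ 1) :
    Set.InjOn (fun p : MvPolynomial (Fin r) F × MvPolynomial (Fin r) F => p.1 * p.2)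
      (monicOfDegree F m 1 ×ˢ irreducibleMonic F m n) := by
  rintro ⟨a, b⟩ ⟨ha, hb⟩ ⟨c, d⟩ ⟨hc, hd⟩ h
  simp only at ha hb hc hd h
  have key : ({a, b} : Multiset (MvPolynomial (Fin r) F)) = {c, d} := by
    refine eq_of_prod_eq_of_monic_irreducible (m := m) ?_ ?_ (by simpa using h)
    · intro f hf
      simp only [Multiset.insert_eq_cons, Multiset.mem_cons, Multiset.mem_singleton] at hf
      rcases hf with rfl | rfl
      exacts [⟨ha.1, irreducible_of_mem_monicOfDegree_one ha⟩, ⟨hb.1.1, hb.2⟩]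
    · intro f hf
      simp only [Multiset.insert_eq_cons, Multiset.mem_cons, Multiset.mem_singleton] at hf
      rcases hf with rfl | rfl
      exacts [⟨hc.1, irreducible_of_mem_monicOfDegree_one hc⟩, ⟨hd.1.1, hd.2⟩]
  have hac : a = c := by
    have : a ∈ ({c, d} : Multiset (MvPolynomial (Fin r) F)) := key ▸ by simp
    simp only [Multiset.insert_eq_cons, Multiset.mem_cons, Multiset.mem_singleton] at this
    rcases this with h | rfl
    · exact h
    · exact absurd (hd.1.2.symm.trans ha.2) hn
  subst hac
  exact Prod.ext rfl (mul_left_cancel₀ ha.1.ne_zero h)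

theorem le_ncard_reducibleMonic_succ [Fintype F] (m : MonomialOrder (Fin r)) {n : ℕ} (hn : 2 ≤ n) :
    (monicOfDegree F m 1).ncard * (irreducibleMonic F m n).ncard ≤
      (reducibleMonic F m (n + 1)).ncard := by
  obtain ⟨n, rfl⟩ : ∃ k, n = k + 1 := ⟨n - 1, by omega⟩
  rw [← Set.ncard_prod, ← (injOn_mul_irreducibleMonic m (by omega)).ncard_image]
  refine Set.ncard_le_ncard ?_ (finite_reducibleMonic m _)
  rintro _ ⟨⟨a, b⟩, ⟨ha, hb⟩, rfl⟩
  rw [add_comm]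
  simpa [add_comm] using mul_mem_reducibleMonic (a := 0) ha hb.1

/-! ### Products of linear polynomials; exact counts in degrees two and three. -/

/-- The product of a multiset of monic polynomials of degree one. -/
noncomputable def linearProd (m : MonomialOrder (Fin r)) (k : ℕ)
    (s : Sym (monicOfDegree F m 1) k) : MvPolynomial (Fin r) F :=
  ((s : Multiset (monicOfDegree F m 1)).map Subtype.val).prod

theorem monic_irreducible_of_mem_map_val (s : Multiset (monicOfDegree F m 1)) :
    ∀ f ∈ s.map Subtype.val, m.Monic f ∧ Irreducible f := by
  intro f hf
  obtain ⟨g, -, rfl⟩ := Multiset.mem_map.mp hf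
  exact ⟨g.2.1, irreducible_of_mem_monicOfDegree_one g.2⟩

theorem linearProd_injective (m : MonomialOrder (Fin r)) (k : ℕ) :
    Function.Injective (linearProd (F := F) m k) := by
  intro s t h
  have := eq_of_prod_eq_of_monic_irreducible (monic_irreducible_of_mem_map_val _)
    (monic_irreducible_of_mem_map_val _) h
  exact Sym.coe_injective (Multiset.map_injective Subtype.val_injective this)

theorem ncard_range_linearProd [Fintype F] (m : MonomialOrder (Fin r)) (k : ℕ) :
    (Set.range (linearProd (F := F) m k)).ncard =
      ((monicOfDegree F m 1).ncard + k - 1).choose k := by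
  classical
  have : Fintype (monicOfDegree F m 1) := (finite_monicOfDegree m 1).fintype
  rw [← Nat.card_coe_set_eq, Nat.card_range_of_injective (linearProd_injective m k),
    Nat.card_eq_fintype_card, Sym.card_sym_eq_choose, ← Nat.card_eq_fintype_card,
    Nat.card_coe_set_eq]

theorem range_linearProd_two (m : MonomialOrder (Fin r)) :
    Set.range (linearProd (F := F) m 2) = reducibleMonic F m 2 := by
  ext f
  constructor
  · rintro ⟨⟨s, hs⟩, rfl⟩
    obtain ⟨a, b, rfl⟩ := Multiset.card_eq_two.mp hs
    simpa [linearProd] using mul_mem_reducibleMonic (a := 0) (b := 0) a.2 b.2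
  · intro hf
    obtain ⟨k, hk, g, hg, h, hh, rfl⟩ := exists_factors_of_mem_reducibleMonic two_ne_zero hf
    obtain rfl : k = 1 := by simp at hk; omega
    exact ⟨⟨{⟨g, hg⟩, ⟨h, hh⟩}, rfl⟩, by simp [linearProd]⟩

theorem reducibleMonic_three (m : MonomialOrder (Fin r)) :
    reducibleMonic F m 3 = Set.range (linearProd (F := F) m 3) ∪
      (fun p : MvPolynomial (Fin r) F × MvPolynomial (Fin r) F => p.1 * p.2) ''
        (monicOfDegree F m 1 ×ˢ irreducibleMonic F m 2) := by
  ext f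
  constructor
  · intro hf
    obtain ⟨k, hk, g, hg, h, hh, rfl⟩ := exists_factors_of_mem_reducibleMonic three_ne_zero hf
    obtain rfl : k = 1 := by simp at hk; omega
    by_cases hirr : h ∈ irreducibleMonic F m 2
    · exact Or.inr ⟨(g, h), ⟨hg, hirr⟩, rfl⟩
    · have : h ∈ reducibleMonic F m 2 := ⟨hh, hirr⟩
      rw [← range_linearProd_two] at this
      obtain ⟨s, rfl⟩ := this
      exact Or.inl ⟨⟨g, hg⟩ ::ₛ s, by simp [linearProd, Sym.coe_cons]⟩
  · rintro (⟨⟨s, hs⟩, rfl⟩ | ⟨⟨a, b⟩, ⟨ha, hb⟩, rfl⟩)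
    · obtain ⟨a, b, c, rfl⟩ := Multiset.card_eq_three.mp hs
      simpa [linearProd] using
        mul_mem_reducibleMonic (a := 0) (b := 1) a.2 (mul_mem_monicOfDegree b.2 c.2)
    · exact mul_mem_reducibleMonic (a := 0) (b := 1) ha hb.1

/-- The two kinds of reducible cubics are disjoint because they have three and two irreducible
factors respectively. -/
theorem ncard_reducibleMonic_three [Fintype F] (m : MonomialOrder (Fin r)) :
    (reducibleMonic F m 3).ncard = ((monicOfDegree F m 1).ncard + 2).choose 3 +
      (monicOfDegree F m 1).ncard * (irreducibleMonic F m 2).ncard := by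
  have hfin : (reducibleMonic F m 3).Finite := finite_reducibleMonic m 3
  rw [reducibleMonic_three] at hfin ⊢
  rw [Set.ncard_union_eq _ (hfin.subset Set.subset_union_left)
    (hfin.subset Set.subset_union_right), ncard_range_linearProd,
    (injOn_mul_irreducibleMonic m (by omega)).ncard_image, Set.ncard_prod]
  · rfl
  · rw [Set.disjoint_left]
    rintro _ ⟨s, rfl⟩ ⟨⟨a, b⟩, ⟨ha, hb⟩, h⟩
    have key := eq_of_prod_eq_of_monic_irreducible (m := m) (s := {a, b}) ?_
      (monic_irreducible_of_mem_map_val (s : Multiset (monicOfDegree F m 1)))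
      (by simpa [linearProd] using h)
    · simpa using congrArg Multiset.card key
    · intro f hf
      simp only [Multiset.insert_eq_cons, Multiset.mem_cons, Multiset.mem_singleton] at hf
      rcases hf with rfl | rfl
      exacts [⟨ha.1, irreducible_of_mem_monicOfDegree_one ha⟩, ⟨hb.1.1, hb.2⟩]

end

/-! ### Decreasing exponents and geometric domination. -/

theorem choose_add_succ (s k : ℕ) :
    (s + 1 + (k + 1)).choose (s + 1) = (s + 1 + k).choose s + (s + 1 + k).choose (s + 1) := by
  rw [← add_assoc, Nat.choose_succ_succ]

theorem choose_lt_choose_top {s a b : ℕ} (hs : 1 ≤ s) (ha : s ≤ a + 1) (hab : a < b) :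
    a.choose s < b.choose s := by
  obtain ⟨s, rfl⟩ : ∃ k, s = k + 1 := ⟨s - 1, by omega⟩
  refine lt_of_lt_of_le ?_ (Nat.choose_le_choose (s + 1) (Nat.succ_le_of_lt hab))
  rw [Nat.succ_eq_add_one, Nat.choose_succ_succ']
  have : 0 < a.choose s := Nat.choose_pos (by omega)
  omega

/-- Convexity of the binomial: by Pascal's rule the two increments are `binom(·, s)` at different
tops. For `s = 0` (one variable) the sums would all be equal. -/
theorem choose_add_choose_lt {s n k : ℕ} (hs : 1 ≤ s) (hk : 2 * (k + 1) ≤ n) :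
    (s + 1 + (k + 1)).choose (s + 1) + (s + 1 + (n - (k + 1))).choose (s + 1) <
      (s + 1 + k).choose (s + 1) + (s + 1 + (n - k)).choose (s + 1) := by
  obtain ⟨l, rfl⟩ : ∃ l, n = k + 1 + l := ⟨n - (k + 1), by omega⟩
  rw [show k + 1 + l - (k + 1) = l by omega, show k + 1 + l - k = l + 1 by omega,
    choose_add_succ, choose_add_succ]
  have := choose_lt_choose_top (s := s) (a := s + 1 + k) (b := s + 1 + l) hs (by omega) (by omega)
  omega

/-- Descending induction on `j`: the tail contributes at most `q ^ (e (j + 1) + 1) ≤ q ^ e j`, and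
`(q - 1) q ^ e j + q ^ e j = q ^ (e j + 1)`. -/
theorem sum_pow_le_of_strictly_decreasing {q : ℝ} (hq : 1 < q) (e : ℕ → ℕ) (N : ℕ)
    (he : ∀ k, k + 1 ≤ N → e (k + 1) < e k) (j : ℕ) :
    (q - 1) * ∑ k ∈ Finset.Icc j N, q ^ e k ≤ q ^ (e j + 1) := by
  have h0 : 0 < q := by linarith
  rcases lt_or_ge N j with h | h
  · rw [Finset.Icc_eq_empty (by omega)]
    simp only [Finset.sum_empty, mul_zero]
    positivity
  · induction h using Nat.decreasingInduction with
    | self =>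
      simp only [Finset.Icc_self, Finset.sum_singleton, pow_succ]
      nlinarith [pow_pos h0 (e N)]
    | of_succ j hj ih =>
      rw [← Finset.insert_Icc_add_one_left_eq_Icc (by omega : j ≤ N),
        Finset.sum_insert (by simp), mul_add]
      have : q ^ (e (j + 1) + 1) ≤ q ^ e j := pow_le_pow_right₀ hq.le (he j hj)
      rw [pow_succ]
      nlinarith

/-! ### Real-valued estimates. -/

section

variable {F : Type*} [Field F] [Fintype F] {s : ℕ}

theorem two_le_cast_card (F : Type*) [Field F] [Fintype F] : (2 : ℝ) ≤ (Fintype.card F : ℝ) := by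
  exact_mod_cast Fintype.one_lt_card (α := F)

theorem cast_ncard_monicOfDegree_succ (m : MonomialOrder (Fin (s + 1))) (n : ℕ) {q : ℝ}
    (hq : q = (Fintype.card F : ℝ)) :
    (q - 1) * ((monicOfDegree F m (n + 1)).ncard : ℝ) =
      q ^ (s + 1 + (n + 1)).choose (s + 1) - q ^ (s + 1 + n).choose (s + 1) := by
  have := congrArg (Nat.cast (R := ℝ)) (ncard_monicOfDegree_succ (F := F) m n)
  have h1 : 1 ≤ Fintype.card F := Fintype.card_pos
  push_cast [Nat.cast_sub h1, ← hq] at this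
  linarith

theorem cast_ncard_monicOfDegree_le (m : MonomialOrder (Fin (s + 1))) (n : ℕ) {q : ℝ}
    (hq : q = (Fintype.card F : ℝ)) :
    (q - 1) * ((monicOfDegree F m n).ncard : ℝ) ≤ q ^ (s + 1 + n).choose (s + 1) := by
  have h2 : 2 ≤ q := hq ▸ two_le_cast_card F
  cases n with
  | zero => simp [ncard_monicOfDegree_zero]
  | succ n =>
    rw [cast_ncard_monicOfDegree_succ m n hq]
    have : 0 < q ^ (s + 1 + n).choose (s + 1) := by positivity
    linarith

/-- Of the three factors `q - 1`, two clear the denominators of the monic counts and one that of the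
geometric series. -/
theorem sum_ncard_mul_ncard_le (hs : 1 ≤ s) (m : MonomialOrder (Fin (s + 1))) (n j : ℕ) {q : ℝ}
    (hq : q = (Fintype.card F : ℝ)) :
    (q - 1) ^ 3 * ∑ k ∈ Finset.Icc j (n / 2),
      ((monicOfDegree F m k).ncard : ℝ) * ((monicOfDegree F m (n - k)).ncard : ℝ) ≤
      q ^ ((s + 1 + j).choose (s + 1) + (s + 1 + (n - j)).choose (s + 1) + 1) := by
  have h2 : 2 ≤ q := hq ▸ two_le_cast_card F
  refine le_trans ?_ (sum_pow_le_of_strictly_decreasing (by linarith : 1 < q)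
    (fun k => (s + 1 + k).choose (s + 1) + (s + 1 + (n - k)).choose (s + 1)) (n / 2)
    (fun k hk => choose_add_choose_lt hs (by omega)) j)
  rw [show (q - 1) ^ 3 = (q - 1) * (q - 1) ^ 2 by ring, mul_assoc, Finset.mul_sum]
  refine mul_le_mul_of_nonneg_left (Finset.sum_le_sum fun k _ => ?_) (by linarith)
  rw [pow_add, show ∀ a b : ℝ, (q - 1) ^ 2 * (a * b) = ((q - 1) * a) * ((q - 1) * b) by
    intros; ring]
  exact mul_le_mul (cast_ncard_monicOfDegree_le m k hq) (cast_ncard_monicOfDegree_le m _ hq)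
    (mul_nonneg (by linarith) (Nat.cast_nonneg _)) (by positivity)

theorem cast_ncard_monicOfDegree_one (m : MonomialOrder (Fin (s + 1))) {q : ℝ}
    (hq : q = (Fintype.card F : ℝ)) :
    (q - 1) * ((monicOfDegree F m 1).ncard : ℝ) = q ^ (s + 2) - q := by
  have := cast_ncard_monicOfDegree_succ m 0 hq
  simpa using this

theorem cast_ncard_reducibleMonic_two (m : MonomialOrder (Fin (s + 1))) :
    ((reducibleMonic F m 2).ncard : ℝ) =
      (monicOfDegree F m 1).ncard * ((monicOfDegree F m 1).ncard + 1) / 2 := by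
  rw [← range_linearProd_two, ncard_range_linearProd, Nat.add_sub_assoc (by norm_num),
    Nat.cast_choose_two]
  push_cast
  ring

theorem cast_choose_three (n : ℕ) : ((n + 2).choose 3 : ℝ) = (n + 2) * (n + 1) * n / 6 := by
  have h := Nat.descFactorial_eq_factorial_mul_choose (n + 2) 3
  simp only [Nat.descFactorial, Nat.factorial, Nat.sub_zero] at h
  have h' := congrArg (Nat.cast (R := ℝ)) h
  rw [show n + 2 - 2 = n by omega, show n + 2 - 1 = n + 1 by omega] at h'
  push_cast at h'
  linarith

theorem cast_ncard_reducibleMonic_three (m : MonomialOrder (Fin (s + 1))) :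
    ((reducibleMonic F m 3).ncard : ℝ) =
      (monicOfDegree F m 1).ncard * (monicOfDegree F m 2).ncard -
      (monicOfDegree F m 1).ncard * ((monicOfDegree F m 1).ncard + 1) *
        ((monicOfDegree F m 1).ncard - 1) / 3 := by
  have hI := congrArg (Nat.cast (R := ℝ)) (ncard_irreducibleMonic_add (F := F) m 2)
  push_cast at hI
  rw [cast_ncard_reducibleMonic_two] at hI
  rw [ncard_reducibleMonic_three]
  push_cast
  rw [cast_choose_three, ← hI]
  ring

theorem rho_eq (s n : ℕ) {q : ℝ} (hq : 2 ≤ q) :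
    (q - 1) ^ 2 * rho (s + 1) (n + 1) q =
      q ^ (s + 1 + n).choose (s + 1) * (q ^ (s + 2) - q) := by
  have h0 : q ≠ 0 := by positivity
  have h1 : q - 1 ≠ 0 := by linarith
  rw [rho, show s + 1 + (n + 1) - 1 = s + 1 + n by omega,
    show ∀ a, a + (s + 1) - 1 = a + s by omega, pow_add, zpow_neg, zpow_neg, zpow_natCast, zpow_one]
  have : 1 - q⁻¹ ≠ 0 := by
    rw [show 1 - q⁻¹ = (q - 1) * q⁻¹ by field_simp]
    positivity
  field_simp
  ring

end

section

variable {F : Type*} [Field F] [Fintype F] {s : ℕ}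

/-- The triangular number `r (r + 1) / 2` with `r = s + 1`, and the binomial coefficients and
exponents expressed through it. -/
theorem exists_triangular (s : ℕ) (hs : 1 ≤ s) : ∃ T U : ℕ,
    (((s + 1 : ℕ) : ℤ) * ((s + 1 : ℕ) + 1) / 2 = T) ∧
    (((s + 1 : ℕ) : ℤ) * ((s + 1 : ℕ) - 1) / 2 = U) ∧ T = U + (s + 1) ∧ s + 2 ≤ T ∧
    (s + 1 + 2).choose (s + 1) = T + (s + 2) := by
  have h1 : (s + 2).choose 2 = (s + 1).choose 1 + (s + 1).choose 2 := Nat.choose_succ_succ _ _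
  have h2 : (s + 2 + 1).choose 2 = (s + 2).choose 1 + (s + 2).choose 2 := Nat.choose_succ_succ _ _
  rw [Nat.choose_one_right] at h1 h2
  have c1 : 2 * (s + 2).choose 2 = (s + 2) * (s + 1) := by
    rw [Nat.choose_two_right, Nat.mul_div_cancel' (Nat.even_mul_pred_self _).two_dvd]; rfl
  refine ⟨(s + 2).choose 2, (s + 1).choose 2, ?_, ?_, by omega, by nlinarith, ?_⟩
  · apply Int.ediv_eq_of_eq_mul_right two_ne_zero
    zify at c1
    push_cast
    linarith
  · apply Int.ediv_eq_of_eq_mul_right two_ne_zero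
    zify at c1 h1
    push_cast
    nlinarith
  · rw [Nat.choose_symm_add, show s + 1 + 2 = s + 2 + 1 by ring]
    omega

theorem cast_ncard_reducibleMonic_le (hs : 1 ≤ s) (m : MonomialOrder (Fin (s + 1))) {n : ℕ}
    (hn : n ≠ 0) {q : ℝ} (hq : q = (Fintype.card F : ℝ)) :
    (q - 1) ^ 3 * ((reducibleMonic F m n).ncard : ℝ) ≤
      q ^ (s + 2 + (s + 1 + (n - 1)).choose (s + 1) + 1) := by
  have h2 : 2 ≤ q := hq ▸ two_le_cast_card F
  have h := sum_ncard_mul_ncard_le hs m n 1 hq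
  rw [show (s + 1 + 1).choose (s + 1) = s + 2 by simp] at h
  refine le_trans (mul_le_mul_of_nonneg_left ?_ (pow_nonneg (by linarith) 3)) h
  exact_mod_cast ncard_reducibleMonic_le m hn

theorem cast_ncard_reducibleMonic_le_add (hs : 1 ≤ s) (m : MonomialOrder (Fin (s + 1))) {n : ℕ}
    (hn : 2 ≤ n) {q : ℝ} (hq : q = (Fintype.card F : ℝ)) :
    (q - 1) ^ 3 * ((reducibleMonic F m n).ncard : ℝ) ≤
      (q - 1) ^ 3 * ((monicOfDegree F m 1).ncard * (monicOfDegree F m (n - 1)).ncard) +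
      q ^ ((s + 1 + 2).choose (s + 1) + (s + 1 + (n - 2)).choose (s + 1) + 1) := by
  have h2 : 2 ≤ q := hq ▸ two_le_cast_card F
  refine le_trans ?_ (add_le_add le_rfl (sum_ncard_mul_ncard_le hs m n 2 hq))
  rw [← mul_add]
  refine mul_le_mul_of_nonneg_left ?_ (pow_nonneg (by linarith) 3)
  have h := ncard_reducibleMonic_le (F := F) m (show n ≠ 0 by omega)
  rw [← Finset.insert_Icc_add_one_left_eq_Icc (by omega : 1 ≤ n / 2),
    Finset.sum_insert (by simp)] at h
  exact_mod_cast h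

/-- The relative error bound for degree at least four, with denominators cleared. -/
theorem abs_ncard_reducibleMonic_sub_rho_le (hs : 1 ≤ s) (m : MonomialOrder (Fin (s + 1))) {k : ℕ}
    (hk : 2 ≤ k) {q : ℝ} (hq : q = (Fintype.card F : ℝ)) :
    (q - 1) ^ 3 * |((reducibleMonic F m (k + 2)).ncard : ℝ) - rho (s + 1) (k + 2) q| ≤
      q ^ ((s + 1 + 2).choose (s + 1) + (s + 1 + k).choose (s + 1) + 1) := by
  have h2 : 2 ≤ q := hq ▸ two_le_cast_card F
  obtain ⟨T, U, -, -, -, hT, hb2⟩ := exists_triangular s hs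
  have hP := cast_ncard_monicOfDegree_one m hq
  have hc := cast_ncard_monicOfDegree_succ m k hq
  have hρ := rho_eq s (k + 1) h2
  have hup := cast_ncard_reducibleMonic_le_add hs m (show 2 ≤ k + 2 by omega) hq
  have hlow := le_ncard_reducibleMonic_succ (F := F) m (show 2 ≤ k + 1 by omega)
  have hI := ncard_irreducibleMonic_add (F := F) m (k + 1)
  have hR := cast_ncard_reducibleMonic_le hs m (show k + 1 ≠ 0 by omega) hq
  rw [show k + 2 - 1 = k + 1 by omega, show k + 2 - 2 = k by omega] at hup
  rw [show k + 1 - 1 = k by omega] at hR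
  rw [hb2] at hup ⊢
  have hlow' : ((monicOfDegree F m 1).ncard : ℝ) * (irreducibleMonic F m (k + 1)).ncard ≤
      (reducibleMonic F m (k + 2)).ncard := by exact_mod_cast hlow
  have hI' : ((irreducibleMonic F m (k + 1)).ncard : ℝ) + (reducibleMonic F m (k + 1)).ncard =
      (monicOfDegree F m (k + 1)).ncard := by exact_mod_cast hI
  have hA : q ≤ q ^ (s + 2) := le_self_pow₀ (by linarith) (by omega)
  have hAB : q ^ (s + 2) ≤ q ^ T := pow_le_pow_right₀ (by linarith) hT
  have hX : 0 < q ^ (s + 1 + k).choose (s + 1) := by positivity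
  rw [pow_succ q, pow_add q, pow_add q] at hup ⊢
  rw [pow_succ q, pow_add q] at hR
  rw [show k + 1 + 1 = k + 2 from rfl] at hρ
  generalize q ^ (s + 1 + k).choose (s + 1) = X at *
  generalize q ^ (s + 1 + (k + 1)).choose (s + 1) = Y at *
  generalize q ^ (s + 2) = A at *
  generalize q ^ T = B at *
  generalize ((monicOfDegree F m 1).ncard : ℝ) = P at *
  generalize ((monicOfDegree F m (k + 1)).ncard : ℝ) = c at *
  generalize ((reducibleMonic F m (k + 2)).ncard : ℝ) = R at *
  generalize ((reducibleMonic F m (k + 1)).ncard : ℝ) = R' at *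
  generalize ((irreducibleMonic F m (k + 1)).ncard : ℝ) = J at *
  generalize rho (s + 1) (k + 2) q = ρ at *
  have hq1 : 0 < q - 1 := by linarith
  have hP0 : 0 ≤ P := by
    by_contra h
    nlinarith
  have hPc : (q - 1) ^ 2 * (P * c) = (q - 1) ^ 2 * ρ - (A - q) * X := by
    rw [hρ, show (q - 1) ^ 2 * (P * c) = ((q - 1) * P) * ((q - 1) * c) by ring, hP, hc]
    ring
  -- `P * c` falls short of `ρ` by a nonnegative amount, which the upper bound discards and the
  -- lower bound must absorb.
  have hmain : (q - 1) ^ 3 * (P * c) = (q - 1) ^ 3 * ρ - (q - 1) * ((A - q) * X) := by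
    linear_combination (q - 1) * hPc
  have hAX : 0 ≤ (A - q) * X := mul_nonneg (by linarith) hX.le
  rw [← abs_of_pos (pow_pos hq1 3), ← abs_mul, abs_le]
  constructor
  · have hlow3 : (q - 1) ^ 3 * (P * J) ≤ (q - 1) ^ 3 * R :=
      mul_le_mul_of_nonneg_left hlow' (by positivity)
    have hR3 : P * ((q - 1) ^ 3 * R') ≤ P * (A * X * q) := mul_le_mul_of_nonneg_left hR hP0
    have hJ : (q - 1) ^ 3 * (P * J) = (q - 1) ^ 3 * (P * c) - P * ((q - 1) ^ 3 * R') := by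
      rw [← hI']; ring
    have hP1 : P ≤ A - 1 := by nlinarith
    -- Up to the common factor `X`, the left side adds the shortfall of `P * c` to the loss from
    -- reducible cofactors.
    have hfin : (q - 1) * (A - q) + P * (A * q) ≤ A * B * q := by
      have h3 : (q - 1) * (A - q) ≤ A * q := by nlinarith
      have h4 : P * (A * q) ≤ (A - 1) * (A * q) :=
        mul_le_mul_of_nonneg_right hP1 (by nlinarith)
      have h5 : A * (A * q) ≤ B * (A * q) := mul_le_mul_of_nonneg_right hAB (by nlinarith)
      linarith
    have := mul_le_mul_of_nonneg_right hfin hX.le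
    linarith
  · have := mul_nonneg hq1.le hAX
    linarith

end

/-! ### Assembly of the main theorem. -/

theorem theorem2p9 (F : Type*) [Field F] [Fintype F] (r : ℕ) (hr : 2 ≤ r)
    (m : MonomialOrder (Fin r)) (q : ℝ) (hq : q = (Fintype.card F : ℝ)) :
    (∀ n : ℕ, (reducibleMonic F m n).Finite) ∧
    (reducibleMonic F m 0).ncard = 1 ∧
    (reducibleMonic F m 1).ncard = 0 ∧
    ((reducibleMonic F m 2).ncard : ℝ) = rho r 2 q / 2 * (1 - q ^ (-(r : ℤ) - 1)) ∧
    |((reducibleMonic F m 3).ncard : ℝ) - rho r 3 q| =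
      rho r 3 q * (q ^ (-((r : ℤ) * (r + 1) / 2)) +
        q ^ (-((r : ℤ) * (r - 1) / 2)) *
          ((1 - 2 * q ^ (-(r : ℤ)) + 2 * q ^ (-2 * (r : ℤ) - 1) - q ^ (-2 * (r : ℤ) - 2)) /
            (3 * (1 - q ^ (-1 : ℤ))))) ∧
    rho r 3 q * (q ^ (-((r : ℤ) * (r + 1) / 2)) +
        q ^ (-((r : ℤ) * (r - 1) / 2)) *
          ((1 - 2 * q ^ (-(r : ℤ)) + 2 * q ^ (-2 * (r : ℤ) - 1) - q ^ (-2 * (r : ℤ) - 2)) /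
            (3 * (1 - q ^ (-1 : ℤ))))) ≤
      rho r 3 q * q ^ (-((r : ℤ) * (r - 1) / 2)) ∧
    ∀ n : ℕ, 4 ≤ n →
      |((reducibleMonic F m n).ncard : ℝ) - rho r n q| ≤
        rho r n q *
          (q ^ (-(((r + n - 2).choose (r - 1) : ℕ) : ℤ) + (r : ℤ) * (r + 1) / 2) /
            ((1 - q ^ (-1 : ℤ)) * (1 - q ^ (-(r : ℤ))))) ∧
      rho r n q *
          (q ^ (-(((r + n - 2).choose (r - 1) : ℕ) : ℤ) + (r : ℤ) * (r + 1) / 2) /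
            ((1 - q ^ (-1 : ℤ)) * (1 - q ^ (-(r : ℤ))))) ≤
        rho r n q *
          (3 * q ^ (-(((r + n - 2).choose (r - 1) : ℕ) : ℤ) + (r : ℤ) * (r + 1) / 2)) := by
  obtain ⟨s, rfl⟩ : ∃ s, r = s + 1 := ⟨r - 1, by omega⟩
  have hs : 1 ≤ s := by omega
  have h2 : 2 ≤ q := hq ▸ two_le_cast_card F
  have h0 : q ≠ 0 := by positivity
  have hq1 : 0 < q - 1 := by linarith
  obtain ⟨T, U, hT1, hU1, hTU, -, hb2⟩ := exists_triangular s hs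
  have hb1 : (s + 1 + 1).choose (s + 1) = s + 2 := by simp
  -- With `t = q^{-r}`, the powers in the degree 2 and 3 formulas become rational expressions in
  -- `q`, `t` and `q ^ U`.
  obtain ⟨t, ht⟩ : ∃ t : ℝ, t = (q ^ (s + 1))⁻¹ := ⟨_, rfl⟩
  have hA : q ^ (s + 2) = q / t := by rw [ht, div_inv_eq_mul, pow_succ' q (s + 1)]
  have ht0 : 0 < t := by rw [ht]; positivity
  have ht4 : t ≤ 1 / 4 := by
    rw [ht, one_div]
    refine inv_anti₀ (by norm_num) ?_
    calc (4 : ℝ) = 2 ^ 2 := by norm_num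
      _ ≤ q ^ 2 := by gcongr
      _ ≤ q ^ (s + 1) := pow_le_pow_right₀ (by linarith) (by omega)
  have zr : q ^ (-((s + 1 : ℕ) : ℤ)) = t := by rw [ht, zpow_neg, zpow_natCast]
  have zr1 : q ^ (-((s + 1 : ℕ) : ℤ) - 1) = t / q := by rw [zpow_sub₀ h0, zr, zpow_one]
  have z2r : q ^ (-2 * ((s + 1 : ℕ) : ℤ)) = t ^ 2 := by
    rw [show -2 * ((s + 1 : ℕ) : ℤ) = -((s + 1 : ℕ) : ℤ) + -((s + 1 : ℕ) : ℤ) by ring,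
      zpow_add₀ h0, zr, sq]
  have z2r1 : q ^ (-2 * ((s + 1 : ℕ) : ℤ) - 1) = t ^ 2 / q := by
    rw [zpow_sub₀ h0, z2r, zpow_one]
  have z2r2 : q ^ (-2 * ((s + 1 : ℕ) : ℤ) - 2) = t ^ 2 / q ^ 2 := by
    rw [zpow_sub₀ h0, z2r, zpow_ofNat]
  have zU : q ^ (-(U : ℤ)) = (q ^ U)⁻¹ := by rw [zpow_neg, zpow_natCast]
  have hBt : q ^ T = q ^ U / t := by rw [hTU, pow_add, ht, div_inv_eq_mul]
  have zT : q ^ (-(T : ℤ)) = t * (q ^ U)⁻¹ := by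
    rw [zpow_neg, zpow_natCast, hBt, inv_div, div_eq_mul_inv]
  have hP := cast_ncard_monicOfDegree_one m hq
  rw [hA] at hP
  have hP' : ((monicOfDegree F m 1).ncard : ℝ) = (q / t - q) / (q - 1) := by
    rw [← hP]; field_simp
  have hρ : ∀ n, rho (s + 1) (n + 1) q =
      q ^ (s + 1 + n).choose (s + 1) * (q / t - q) / (q - 1) ^ 2 := by
    intro n
    rw [← hA, ← rho_eq s n h2]
    field_simp
  have hAq : 0 < q / t - q := by
    have : q < q / t := (lt_div_iff₀ ht0).mpr (by nlinarith)
    linarith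
  have hρ0 : ∀ n, 0 < rho (s + 1) (n + 1) q := fun n => by rw [hρ]; positivity
  have hqi : 1 - q⁻¹ = (q - 1) / q := by field_simp
  rw [hT1, hU1, zr, zr1, z2r1, z2r2, zT, zU, zpow_neg_one]
  refine ⟨finite_reducibleMonic m, ?_, ?_, ?_, ?_, ?_, ?_⟩
  · rw [reducibleMonic_zero, ncard_monicOfDegree_zero]
  · rw [reducibleMonic_one, Set.ncard_empty]
  · rw [cast_ncard_reducibleMonic_two, hP', hρ 1, hb1, hA]
    field_simp
    ring
  · have hc := cast_ncard_monicOfDegree_succ m 1 hq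
    rw [hb1, hb2, pow_add, hA, hBt] at hc
    have hc' : ((monicOfDegree F m 2).ncard : ℝ) = (q ^ U / t * (q / t) - q / t) / (q - 1) := by
      rw [← hc]; field_simp
    have hR : ((reducibleMonic F m 3).ncard : ℝ) - rho (s + 1) 3 q =
        -(q / t * (q / t - q) / (q - 1) ^ 2 + (monicOfDegree F m 1).ncard *
          ((monicOfDegree F m 1).ncard + 1) * ((monicOfDegree F m 1).ncard - 1) / 3) := by
      rw [cast_ncard_reducibleMonic_three, hc', hρ 2, hb2, pow_add, hA, hBt, hP']
      field_simp
      ring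
    -- This fixes the sign of the discrepancy, so the absolute value is computed exactly.
    have hP1 : (1 : ℝ) ≤ (monicOfDegree F m 1).ncard := by
      have : (0 : ℝ) < (monicOfDegree F m 1).ncard := by rw [hP']; positivity
      exact_mod_cast this
    rw [hR, abs_neg, abs_of_nonneg, hρ 2, hb2, pow_add, hA, hBt, hP', hqi]
    · have hU : q ^ U ≠ 0 := by positivity
      field_simp
      ring
    · have : 0 ≤ ((monicOfDegree F m 1).ncard : ℝ) - 1 := by linarith
      positivity
  · refine mul_le_mul_of_nonneg_left ?_ (hρ0 2).le
    have hU : 0 < (q ^ U)⁻¹ := by positivity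
    rw [mul_comm t, ← mul_add]
    refine mul_le_of_le_one_right hU.le ?_
    -- The second summand is at most `(2/3)(1 - t)^2 ≤ 1 - t`, which leaves room for the first
    -- summand `t`.
    have hqi2 : 1 / 2 ≤ 1 - q⁻¹ := by
      have := inv_anti₀ (by norm_num) h2
      linarith
    have hW : 1 - 2 * t + 2 * (t ^ 2 / q) - t ^ 2 / q ^ 2 ≤ (1 - t) ^ 2 := by
      have h3 : t ^ 2 / q ≤ t ^ 2 / 2 := div_le_div_of_nonneg_left (by positivity) (by norm_num) h2
      have h4 : 0 ≤ t ^ 2 / q ^ 2 := by positivity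
      nlinarith
    have h5 : (1 - 2 * t + 2 * (t ^ 2 / q) - t ^ 2 / q ^ 2) / (3 * (1 - q⁻¹)) ≤
        (1 - t) ^ 2 / (3 * (1 / 2)) :=
      div_le_div₀ (sq_nonneg _) hW (by norm_num) (by linarith)
    have h6 : (1 - t) ^ 2 / (3 * (1 / 2)) ≤ 1 - t := by
      rw [div_le_iff₀ (by norm_num)]
      nlinarith
    linarith
  · intro n hn
    obtain ⟨k, rfl⟩ : ∃ k, n = k + 2 := ⟨n - 2, by omega⟩
    rw [show s + 1 + (k + 2) - 2 = s + 1 + k by omega, show s + 1 - 1 = s by omega]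
    have hD : q ^ (-(((s + 1 + k).choose s : ℕ) : ℤ) + (T : ℤ)) =
        q ^ T / q ^ (s + 1 + k).choose s := by
      rw [zpow_add₀ h0, zpow_neg, zpow_natCast, zpow_natCast, div_eq_mul_inv, mul_comm]
    rw [hD, hqi]
    have ht1 : 0 < 1 - t := by linarith
    constructor
    · have h := abs_ncard_reducibleMonic_sub_rho_le (F := F) hs m (show 2 ≤ k by omega) hq
      rw [← le_div_iff₀' (by positivity), hb2, pow_succ q, pow_add q, pow_add q, hA] at h
      refine h.trans (le_of_eq ?_)
      -- Pascal's rule cancels the `binom(r+n-2, r-1)` in the exponent, so this is an equality.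
      rw [hρ (k + 1), choose_add_succ, pow_add]
      field_simp
    · refine mul_le_mul_of_nonneg_left ?_ (hρ0 (k + 1)).le
      rw [div_le_iff₀ (by positivity), mul_right_comm]
      refine le_mul_of_one_le_left (by positivity) ?_
      have hqi2 : 1 / 2 ≤ (q - 1) / q := by
        rw [div_le_div_iff₀ (by norm_num) (by linarith)]
        linarith
      -- The constant 3 suffices since `(1/2)(3/4) = 3/8 ≥ 1/3`.
      nlinarith [mul_le_mul hqi2 (show 3 / 4 ≤ 1 - t by linarith) (by norm_num) (by positivity)]
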